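/- Let $a_1,\dots,a_m\in\mathbb{R}^n$ be unit vectors and let $A$ be the $m\times n$ matrix with rows $a_1^\top,\dots,a_m^\top$. For $I\subseteq\{1,\dots,m\}$ let $P_I$ be the orthogonal projection of $\mathbb{R}^n$ onto $\{x : a_i^\top x=0 \text{ for all } i\in I\}$, so that $P_\emptyset$ is the identity. Put $$\alpha=\tfrac12\min\bigl\{\|P_I a_j\|^2 : I\subseteq\{1,\dots,m\},\ 1\le j\le m,\ P_I a_j\neq 0\bigr\},\qquad c=6\left(\frac1\alpha\right)^{\operatorname{rank}(A)/2}$$ (if $m=0$ the minimum is over the empty set, $\operatorname{rank}(A)=0$, $c=6$, and $\alpha$ may be taken to be any number in $(0,1/2]$). Then $\alpha\in(0,1/2]$, and for all $b_1,\dots,b_m\in\mathbb{R}$ the following holds for the polyhedron $K=\{x\in\mathbb{R}^n : a_i^\top x\le b_i \text{ for } i=1,\dots,m\}$. For a function $y:[0,\infty)\to\mathbb{R}^n$ that is right-continuous with left limits and has $y_0\in K$, call $x:[0,\infty)\to\mathbb{R}^n$ a Skorokhod solution on $K$ for $y$, written $x=\mathcal{S}(y)$, if $x_t=y_t+\phi_t\in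 K$ for all $t\ge 0$, where $\phi_t=-\int_{[0,t]}v_s\,d\mu(s)$ for some Borel measure $\mu$ on $[0,\infty)$ with $\mu([0,T))<\infty$ for all $T>0$ and some $\mu$-measurable $v$ such that, for every $s$, $\|v_s\|\in\{0,1\}$ and $v_s$ lies in the normal cone $N_K(x_s)=\{v : v^\top(z-x_s)\le 0 \text{ for all } z\in K\}$. If $x=\mathcal{S}(y)$ and $x'=\mathcal{S}(y')$ are Skorokhod solutions on $K$, then for all $t\ge0$ $$\sup_{0\le s\le t}\|x_s-x'_s\|\le (c+1)\sup_{0\le s\le t}\|y_s-y'_s\|.$$ -/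

import Mathlib

open MeasureTheory Filter Topology
open scoped NNReal ENNReal

/-- The polyhedron `{x | aᵢᵀ x ≤ bᵢ for all i}` in `ℝⁿ`. -/
def polyhedron {n m : ℕ} (a : Fin m → EuclideanSpace ℝ (Fin n)) (b : Fin m → ℝ) :
    Set (EuclideanSpace ℝ (Fin n)) :=
  {x | ∀ i, inner ℝ (a i) x ≤ b i}

/-- The (outward) normal cone of `K` at a point `x` of `K`. -/
def normalCone {n : ℕ} (K : Set (EuclideanSpace ℝ (Fin n))) (x : EuclideanSpace ℝ (Fin n)) :
    Set (EuclideanSpace ℝ (Fin n)) :=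
  {v | ∀ z ∈ K, inner ℝ v (z - x) ≤ 0}

/-- A trajectory `[0, ∞) → ℝⁿ` that is right-continuous with left limits. -/
def IsCadlag {n : ℕ} (y : ℝ≥0 → EuclideanSpace ℝ (Fin n)) : Prop :=
  ∀ t, ContinuousWithinAt y (Set.Ici t) t ∧ ∃ l, Tendsto y (𝓝[<] t) (𝓝 l)

/-- `(x, φ)` solves the Skorokhod problem on `K` for the trajectory `y`: `x = y + φ` stays in `K`
and `φ t = -∫₀ᵗ v dμ`, where `v s` is zero or a unit vector of the normal cone of `K` at `x s`, and
the measure `μ` on `[0, ∞)` is finite on every `[0, T)`. The integral runs over the closed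
interval `[0, t]`. -/
structure SolvesSkorokhod {n : ℕ} (K : Set (EuclideanSpace ℝ (Fin n)))
    (y x φ : ℝ≥0 → EuclideanSpace ℝ (Fin n)) : Prop where
  cadlag : IsCadlag y
  init_mem : y 0 ∈ K
  eq_add : ∀ t, x t = y t + φ t
  mem : ∀ t, x t ∈ K
  reflection : ∃ (v : ℝ≥0 → EuclideanSpace ℝ (Fin n)) (μ : Measure ℝ≥0),
    AEStronglyMeasurable v μ ∧
    (∀ T, μ (Set.Ico 0 T) < ∞) ∧
    (∀ s, ‖v s‖ = 0 ∨ ‖v s‖ = 1) ∧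
    (∀ s, v s ∈ normalCone K (x s)) ∧
    ∀ t, φ t = -∫ s in Set.Icc 0 t, v s ∂μ

/-- `x = S(y)`: `x` is a Skorokhod solution on `K` for the trajectory `y`. -/
def IsSkorokhodSolution {n : ℕ} (K : Set (EuclideanSpace ℝ (Fin n)))
    (y x : ℝ≥0 → EuclideanSpace ℝ (Fin n)) : Prop :=
  ∃ φ, SolvesSkorokhod K y x φ

/-- The matrix `A` whose rows are the vectors `aᵢᵀ`. -/
def rowMatrix {n m : ℕ} (a : Fin m → EuclideanSpace ℝ (Fin n)) : Matrix (Fin m) (Fin n) ℝ :=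
  Matrix.of fun i j => a i j

/-- The null space of the matrix `A_I` whose rows are the `aᵢᵀ` with `i ∈ I`
(all of `ℝⁿ` when `I` is empty). -/
def nullSpace {n m : ℕ} (a : Fin m → EuclideanSpace ℝ (Fin n)) (I : Finset (Fin m)) :
    Submodule ℝ (EuclideanSpace ℝ (Fin n)) where
  carrier := {x | ∀ i ∈ I, inner ℝ (a i) x = 0}
  zero_mem' := fun i _ => inner_zero_right (a i)
  add_mem' := fun hx hy i hi => by rw [inner_add_right, hx i hi, hy i hi, add_zero]
  smul_mem' := fun r x hx i hi => by rw [inner_smul_right, hx i hi, mul_zero]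

/-- The set of all nonzero values `‖P_I aⱼ‖²`, where `I ⊆ {1, …, m}`, `j ∈ {1, …, m}` and `P_I` is
the orthogonal projection onto the null space of `A_I`. -/
def projNormSqs {n m : ℕ} (a : Fin m → EuclideanSpace ℝ (Fin n)) : Set ℝ :=
  {r | ∃ (I : Finset (Fin m)) (j : Fin m),
    (nullSpace a I).starProjection (a j) ≠ 0 ∧
    r = ‖(nullSpace a I).starProjection (a j)‖ ^ 2}

/-! ### Null-space projections and ranks. -/

section Potential

variable {n m : ℕ}

/-! Put `q = 1/α` and `z = φ - φ'`. If `x` reflects at a facet `i`, then `⟪x - x', aᵢ⟫ ≥ 0`, so `⟪z,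
aᵢ⟫ ≥ -M` when the inputs differ by at most `M`; if `x'` reflects, `⟪z, aᵢ⟫ ≤ M`. So it suffices to
find a convex function that, for `ε > M`, does not increase along `-aᵢ` where `⟪z, aᵢ⟫ > -ε`, nor
along `aᵢ` where `⟪z, aᵢ⟫ < ε`.

`potential` is such a function: the maximum over `I` of `‖P_I z‖²` plus a height growing
geometrically with the rank of `I`. The sign property is `inner_starProjection_nonneg`, and
`le_of_subgradient_descent` turns it into monotonicity along paths with jumps. Then `‖z‖² ≤
potential z ≤ potential 0 ≤ 4 ε² q ^ rank`; letting `ε` decrease to `M` gives the constant `2 q ^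
(rank / 2)`, below the claimed 6. -/

theorem mem_nullSpace {a : Fin m → EuclideanSpace ℝ (Fin n)} {I : Finset (Fin m)}
    {x : EuclideanSpace ℝ (Fin n)} : x ∈ nullSpace a I ↔ ∀ i ∈ I, inner ℝ (a i) x = 0 :=
  Iff.rfl

theorem nullSpace_empty (a : Fin m → EuclideanSpace ℝ (Fin n)) : nullSpace a ∅ = ⊤ := by
  ext x
  simp [mem_nullSpace]

theorem starProjection_nullSpace_empty (a : Fin m → EuclideanSpace ℝ (Fin n))
    (x : EuclideanSpace ℝ (Fin n)) : (nullSpace a ∅).starProjection x = x :=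
  Submodule.starProjection_eq_self_iff.2 (by rw [nullSpace_empty]; exact Submodule.mem_top)

theorem nullSpace_anti (a : Fin m → EuclideanSpace ℝ (Fin n)) {I J : Finset (Fin m)}
    (h : I ⊆ J) : nullSpace a J ≤ nullSpace a I :=
  fun _ hx i hi => hx i (h hi)

theorem inner_starProjection_self_left {E : Type*} [NormedAddCommGroup E] [InnerProductSpace ℝ E]
    (N : Submodule ℝ E) [N.HasOrthogonalProjection] (x y : E) :
    inner ℝ (N.starProjection x) (N.starProjection y) = inner ℝ (N.starProjection x) y := by
  rw [← N.inner_starProjection_left_eq_right, N.starProjection_eq_self_iff.2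
    (N.starProjection_apply_mem x)]

theorem norm_sub_starProjection_sq {E : Type*} [NormedAddCommGroup E] [InnerProductSpace ℝ E]
    (N : Submodule ℝ E) [N.HasOrthogonalProjection] (x : E) :
    ‖x - N.starProjection x‖ ^ 2 = ‖x‖ ^ 2 - ‖N.starProjection x‖ ^ 2 := by
  have h1 := inner_starProjection_self_left N x x
  rw [real_inner_self_eq_norm_sq, real_inner_comm] at h1
  rw [norm_sub_sq_real, ← h1]
  ring

/-- The rank of the family `aᵢ`, `i ∈ I`. -/
noncomputable def subrank (a : Fin m → EuclideanSpace ℝ (Fin n)) (I : Finset (Fin m)) : ℕ :=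
  Module.finrank ℝ (nullSpace a I)ᗮ

theorem subrank_empty (a : Fin m → EuclideanSpace ℝ (Fin n)) : subrank a ∅ = 0 := by
  simp [subrank, nullSpace_empty]

theorem subrank_mono (a : Fin m → EuclideanSpace ℝ (Fin n)) {I J : Finset (Fin m)}
    (h : I ⊆ J) : subrank a I ≤ subrank a J :=
  Submodule.finrank_mono (Submodule.orthogonal_le (nullSpace_anti a h))

/-- Equal orthogonal complements would put `a j` in `(nullSpace a I)ᗮ`, where its projection
vanishes. -/
theorem subrank_lt_subrank_insert (a : Fin m → EuclideanSpace ℝ (Fin n)) {I : Finset (Fin m)}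
    {j : Fin m} (h : (nullSpace a I).starProjection (a j) ≠ 0) :
    subrank a I < subrank a (insert j I) := by
  apply Submodule.finrank_lt_finrank_of_lt
  refine lt_of_le_of_ne (Submodule.orthogonal_le (nullSpace_anti a (Finset.subset_insert j I))) ?_
  intro he
  apply h
  rw [Submodule.starProjection_apply_eq_zero_iff, he]
  intro u hu
  rw [real_inner_comm]
  exact hu j (Finset.mem_insert_self j I)

theorem subrank_univ (a : Fin m → EuclideanSpace ℝ (Fin n)) :
    subrank a Finset.univ = (rowMatrix a).rank := by
  have h1 := Submodule.finrank_add_finrank_orthogonal (nullSpace a Finset.univ)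
  have h2 := LinearMap.finrank_range_add_finrank_ker (rowMatrix a).mulVecLin
  have h3 : Module.finrank ℝ (nullSpace a Finset.univ) =
      Module.finrank ℝ (LinearMap.ker (rowMatrix a).mulVecLin) := by
    have : (nullSpace a Finset.univ) = (LinearMap.ker (rowMatrix a).mulVecLin).map
        (WithLp.linearEquiv 2 ℝ (Fin n → ℝ)).symm.toLinearMap := by
      rw [Submodule.map_equiv_eq_comap_symm]
      ext x
      simp only [mem_nullSpace, Finset.mem_univ, true_implies, Submodule.mem_comap,
        LinearMap.mem_ker, Matrix.mulVecLin_apply, funext_iff]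
      refine forall_congr' fun i => ?_
      simp [Matrix.mulVec, dotProduct, rowMatrix, PiLp.inner_apply, mul_comm]
    rw [this, LinearEquiv.finrank_map_eq]
  have h4 : (rowMatrix a).rank = Module.finrank ℝ (LinearMap.range (rowMatrix a).mulVecLin) := rfl
  simp only [finrank_euclideanSpace, Fintype.card_fin, Module.finrank_fin_fun] at h1 h2
  rw [subrank, h4]
  omega

/-! ### The convex potential and its subgradients. -/

/-- One of the quadratic functions whose maximum is `potential`. -/
noncomputable def potentialTerm (a : Fin m → EuclideanSpace ℝ (Fin n)) (q ε : ℝ)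
    (I : Finset (Fin m)) (z : EuclideanSpace ℝ (Fin n)) : ℝ :=
  ε ^ 2 * (4 * (q ^ subrank a I - 1)) + ‖(nullSpace a I).starProjection z‖ ^ 2

/-- A convex function which, at points `z` with `⟪z, aᵢ⟫ > -ε`, does not increase in
direction `-aᵢ`. -/
noncomputable def potential (a : Fin m → EuclideanSpace ℝ (Fin n)) (q ε : ℝ)
    (z : EuclideanSpace ℝ (Fin n)) : ℝ :=
  Finset.univ.sup' Finset.univ_nonempty fun I => potentialTerm a q ε I z

theorem potentialTerm_le_potential (a : Fin m → EuclideanSpace ℝ (Fin n)) (q ε : ℝ)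
    (I : Finset (Fin m)) (z : EuclideanSpace ℝ (Fin n)) :
    potentialTerm a q ε I z ≤ potential a q ε z :=
  Finset.le_sup' (fun I => potentialTerm a q ε I z) (Finset.mem_univ I)

theorem norm_sq_le_potential (a : Fin m → EuclideanSpace ℝ (Fin n)) (q ε : ℝ)
    (z : EuclideanSpace ℝ (Fin n)) : ‖z‖ ^ 2 ≤ potential a q ε z := by
  refine le_trans (le_of_eq ?_) (potentialTerm_le_potential a q ε ∅ z)
  simp only [potentialTerm, subrank_empty, starProjection_nullSpace_empty,
    pow_zero, sub_self, mul_zero, zero_add]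

theorem potential_zero_le (a : Fin m → EuclideanSpace ℝ (Fin n)) {q : ℝ} (hq : 1 ≤ q) (ε : ℝ) :
    potential a q ε 0 ≤ ε ^ 2 * (4 * q ^ (rowMatrix a).rank) := by
  refine Finset.sup'_le _ _ fun I _ => ?_
  rw [potentialTerm, map_zero, norm_zero, ← subrank_univ]
  have := pow_le_pow_right₀ hq (subrank_mono a (Finset.subset_univ I))
  have h : ε ^ 2 * (4 * (q ^ subrank a I - 1)) ≤ ε ^ 2 * (4 * q ^ subrank a Finset.univ) := by
    gcongr
    linarith
  linarith

theorem potentialTerm_subgradient (a : Fin m → EuclideanSpace ℝ (Fin n)) (q ε : ℝ)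
    (I : Finset (Fin m)) (z w : EuclideanSpace ℝ (Fin n)) :
    potentialTerm a q ε I z + inner ℝ ((2 : ℝ) • (nullSpace a I).starProjection z) (w - z) ≤
      potentialTerm a q ε I w := by
  have h := sq_nonneg ‖(nullSpace a I).starProjection w - (nullSpace a I).starProjection z‖
  rw [norm_sub_sq_real, real_inner_comm, inner_starProjection_self_left] at h
  have h1 := inner_starProjection_self_left (nullSpace a I) z z
  rw [real_inner_self_eq_norm_sq] at h1
  simp only [potentialTerm, inner_smul_left, inner_sub_right, ← h1, conj_trivial]
  linarith

/-- Adding `j` to `I` only removes from `P_I z` its component along `w = P_I aⱼ`, so the squared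
norm drops by `⟪P_I z, aⱼ⟫² / ‖w‖²`; equality in fact holds. -/
theorem norm_starProjection_sq_le_insert (a : Fin m → EuclideanSpace ℝ (Fin n))
    {I : Finset (Fin m)} {j : Fin m} (h : (nullSpace a I).starProjection (a j) ≠ 0)
    (z : EuclideanSpace ℝ (Fin n)) :
    ‖(nullSpace a I).starProjection (a j)‖ ^ 2 * (‖(nullSpace a I).starProjection z‖ ^ 2 -
      ‖(nullSpace a (insert j I)).starProjection z‖ ^ 2) ≤
      inner ℝ ((nullSpace a I).starProjection z) (a j) ^ 2 := by
  set N := nullSpace a I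
  set N' := nullSpace a (insert j I)
  set w := N.starProjection (a j) with hw
  set p := N.starProjection z with hp
  have hs : ‖w‖ ^ 2 ≠ 0 := by simpa using h
  have hww : inner ℝ w (a j) = ‖w‖ ^ 2 := by
    rw [← real_inner_self_eq_norm_sq, hw, inner_starProjection_self_left]
  have hpw : inner ℝ p w = inner ℝ p (a j) := by
    rw [hp, hw, inner_starProjection_self_left]
  set c := inner ℝ p (a j) with hc
  set u := p - (c / ‖w‖ ^ 2) • w with hu
  have huN : u ∈ N := N.sub_mem (N.starProjection_apply_mem _)
    (N.smul_mem _ (N.starProjection_apply_mem _))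
  have hu' : u ∈ N' := by
    intro i hi
    rcases Finset.mem_insert.1 hi with rfl | hi
    · rw [real_inner_comm, hu, inner_sub_left, inner_smul_left, hww, ← hc]
      simp only [conj_trivial]
      field_simp
      ring
    · exact huN i hi
  have hunorm : ‖u‖ ^ 2 = ‖p‖ ^ 2 - c ^ 2 / ‖w‖ ^ 2 := by
    rw [hu, norm_sub_sq_real, inner_smul_right, hpw, norm_smul, mul_pow, Real.norm_eq_abs, sq_abs]
    field_simp
    ring
  have hproj : N'.starProjection z = u := by
    refine Submodule.eq_starProjection_of_mem_of_inner_eq_zero hu' fun y hy => ?_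
    have hyN : y ∈ N := nullSpace_anti a (Finset.subset_insert j I) hy
    have e1 : inner ℝ (z - p) y = 0 := Submodule.starProjection_inner_eq_zero z y hyN
    have e2 : inner ℝ (a j - w) y = 0 := Submodule.starProjection_inner_eq_zero (a j) y hyN
    have e3 : inner ℝ (a j) y = 0 := hy j (Finset.mem_insert_self j I)
    rw [inner_sub_left] at e1 e2
    rw [hu, inner_sub_left, inner_sub_left, inner_smul_left]
    simp only [conj_trivial]
    rw [show inner ℝ w y = 0 by linarith]
    linarith
  rw [hproj, hunorm]
  apply le_of_eq
  field_simp
  ring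

/-- This inequality dictates the heights `4 (q ^ d - 1)`: the gain from one more unit of rank must
outweigh the error in `inner_starProjection_nonneg`, with `s = ‖P_I aⱼ‖²`. -/
theorem height_gap {q s : ℝ} (hq : 2 ≤ q) (hs : 2 / q ≤ s) (d : ℕ) :
    4 + 2 * (1 - s) * (4 * (q ^ d - 1)) ≤ s * (4 * (q ^ (d + 1) - 1) - 4 * (q ^ d - 1)) := by
  have hq0 : 0 < q := by linarith
  have h1 : 2 ≤ s * q := (div_le_iff₀ hq0).1 hs
  have hs0 : 0 < s := lt_of_lt_of_le (by positivity) hs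
  have hd : 1 ≤ q ^ d := one_le_pow₀ (by linarith)
  rw [pow_succ]
  rcases Nat.eq_zero_or_pos d with rfl | hd0
  · nlinarith
  · nlinarith [mul_le_mul_of_nonneg_left h1 (by linarith : 0 ≤ q ^ d - 1)]

/-- If `c = ⟪P_I z, aⱼ⟫` were negative, maximality against `insert j I` would force `|c|` to be
large, while maximality against `∅` keeps `z - P_I z` short, so that `⟪z, aⱼ⟫ > -ε` forces `|c|` to
be small. -/
theorem inner_starProjection_nonneg {a : Fin m → EuclideanSpace ℝ (Fin n)}
    (ha : ∀ i, ‖a i‖ = 1) {q ε : ℝ} (hq : 2 ≤ q) (hε : 0 < ε)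
    (hmin : ∀ (I : Finset (Fin m)) (j : Fin m), (nullSpace a I).starProjection (a j) ≠ 0 →
      2 / q ≤ ‖(nullSpace a I).starProjection (a j)‖ ^ 2)
    {I : Finset (Fin m)} {z : EuclideanSpace ℝ (Fin n)}
    (hmax : ∀ J, potentialTerm a q ε J z ≤ potentialTerm a q ε I z) {j : Fin m}
    (hz : -ε < inner ℝ z (a j)) : 0 ≤ inner ℝ ((nullSpace a I).starProjection z) (a j) := by
  by_cases hw : (nullSpace a I).starProjection (a j) = 0
  · rw [← inner_starProjection_self_left, hw, inner_zero_right]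
  by_contra! hneg
  have h1 := norm_starProjection_sq_le_insert a hw z
  have h2 := hmin I j hw
  have h3 := hmax (insert j I)
  have h4 := hmax ∅
  have h5 := norm_sub_starProjection_sq (nullSpace a I) z
  have h6 := norm_sub_starProjection_sq (nullSpace a I) (a j)
  have h7 := real_inner_le_norm (z - (nullSpace a I).starProjection z)
    (a j - (nullSpace a I).starProjection (a j))
  have h8 : inner ℝ (z - (nullSpace a I).starProjection z)
      (a j - (nullSpace a I).starProjection (a j)) =
      inner ℝ z (a j) - inner ℝ ((nullSpace a I).starProjection z) (a j) := by
    rw [inner_sub_right, Submodule.starProjection_inner_eq_zero _ _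
      (Submodule.starProjection_apply_mem _ _), inner_sub_left, sub_zero]
  rw [h8] at h7
  have h9 := height_gap hq h2 (subrank a I)
  have h10 : q ^ (subrank a I + 1) ≤ q ^ subrank a (insert j I) :=
    pow_le_pow_right₀ (by linarith) (subrank_lt_subrank_insert a hw)
  simp only [potentialTerm, subrank_empty, starProjection_nullSpace_empty,
    pow_zero, sub_self, mul_zero, zero_add] at h3 h4
  rw [ha j, one_pow] at h6
  set P := (nullSpace a I).starProjection z
  set w := (nullSpace a I).starProjection (a j)
  set D := 4 * (q ^ subrank a I - 1)
  set c := inner ℝ P (a j)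
  set y := ‖z - P‖ * ‖a j - w‖ with hy
  have hy2 : y ^ 2 ≤ ε ^ 2 * D * (1 - ‖w‖ ^ 2) := by
    rw [hy, mul_pow, ← h6]
    gcongr
    linarith
  have hgap : ε ^ 2 * (4 * (q ^ (subrank a I + 1) - 1) - D) ≤
      ‖P‖ ^ 2 - ‖(nullSpace a (insert j I)).starProjection z‖ ^ 2 := by
    have : ε ^ 2 * (4 * (q ^ (subrank a I + 1) - 1)) ≤
        ε ^ 2 * (4 * (q ^ subrank a (insert j I) - 1)) := by gcongr
    linarith
  have hc : ε ^ 2 * (4 + 2 * (1 - ‖w‖ ^ 2) * D) ≤ c ^ 2 := by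
    refine le_trans ?_ h1
    refine le_trans ?_ (mul_le_mul_of_nonneg_left hgap (sq_nonneg _))
    linarith [mul_le_mul_of_nonneg_left h9 (sq_nonneg ε)]
  have hlt : c ^ 2 < (ε + y) ^ 2 := by
    rw [sq_lt_sq, abs_of_neg hneg]
    exact lt_of_lt_of_le (by linarith) (le_abs_self _)
  -- Here `c² ≥ 4ε² + 2y²`, whereas `(ε + y)² ≤ 2ε² + 2y²`.
  nlinarith [sq_nonneg (ε - y)]

theorem exists_potential_subgradient {a : Fin m → EuclideanSpace ℝ (Fin n)}
    (ha : ∀ i, ‖a i‖ = 1) {q ε : ℝ} (hq : 2 ≤ q) (hε : 0 < ε)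
    (hmin : ∀ (I : Finset (Fin m)) (j : Fin m), (nullSpace a I).starProjection (a j) ≠ 0 →
      2 / q ≤ ‖(nullSpace a I).starProjection (a j)‖ ^ 2)
    (z : EuclideanSpace ℝ (Fin n)) :
    ∃ ξ : EuclideanSpace ℝ (Fin n),
      (∀ w, potential a q ε z + inner ℝ ξ (w - z) ≤ potential a q ε w) ∧
      (∀ j, -ε < inner ℝ z (a j) → 0 ≤ inner ℝ ξ (a j)) ∧
      (∀ j, inner ℝ z (a j) < ε → inner ℝ ξ (a j) ≤ 0) := by
  obtain ⟨I, -, hI⟩ := Finset.exists_mem_eq_sup' (s := Finset.univ) Finset.univ_nonempty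
    fun I => potentialTerm a q ε I z
  have hmax : ∀ J, potentialTerm a q ε J z ≤ potentialTerm a q ε I z := fun J =>
    (potentialTerm_le_potential a q ε J z).trans_eq hI
  refine ⟨(2 : ℝ) • (nullSpace a I).starProjection z, fun w => ?_, fun j hj => ?_, fun j hj => ?_⟩
  · rw [potential, hI]
    exact (potentialTerm_subgradient a q ε I z w).trans (potentialTerm_le_potential a q ε I w)
  · rw [real_inner_smul_left]
    have := inner_starProjection_nonneg ha hq hε hmin hmax hj
    positivity
  · rw [real_inner_smul_left]
    -- Every term is even in `z`, so `I` is also maximizing at `-z`.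
    have := inner_starProjection_nonneg (z := -z) ha hq hε hmin (I := I) (j := j)
      (fun J => by simpa only [potentialTerm, map_neg, norm_neg] using hmax J)
      (by rw [inner_neg_left]; linarith)
    rw [map_neg, inner_neg_left] at this
    linarith

/-- A vector that makes nonnegative inner products with the normals of the facets through `x` does
so with every vector of the normal cone at `x`. -/
theorem inner_nonneg_of_mem_normalCone {a : Fin m → EuclideanSpace ℝ (Fin n)} {b : Fin m → ℝ}
    {x v ξ : EuclideanSpace ℝ (Fin n)} (hx : x ∈ polyhedron a b)
    (hv : v ∈ normalCone (polyhedron a b) x)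
    (hξ : ∀ i, inner ℝ (a i) x = b i → 0 ≤ inner ℝ ξ (a i)) : 0 ≤ inner ℝ ξ v := by
  -- Small steps along `-ξ` stay in the polyhedron: active constraints by sign, inactive ones by
  -- continuity. This replaces Farkas' lemma.
  have hev : ∀ᶠ r in 𝓝[>] (0 : ℝ), x - r • ξ ∈ polyhedron a b := by
    refine eventually_all.2 fun i => ?_
    rcases (hx i).eq_or_lt with h | h
    · filter_upwards [self_mem_nhdsWithin] with r hr
      have h1 := hξ i h
      have h2 : 0 ≤ r * inner ℝ ξ (a i) := mul_nonneg (le_of_lt hr) h1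
      rw [inner_sub_right, real_inner_smul_right, real_inner_comm ξ]
      linarith
    · refine nhdsWithin_le_nhds ?_
      have hc : Continuous fun r : ℝ => inner ℝ (a i) (x - r • ξ) := by fun_prop
      have := hc.tendsto 0
      simp only [zero_smul, sub_zero] at this
      exact (this.eventually_lt_const h).mono fun r hr => hr.le
  obtain ⟨r, hr, hr0⟩ := (hev.and self_mem_nhdsWithin).exists
  have := hv _ hr
  rw [sub_sub_cancel_left, inner_neg_right, real_inner_smul_right, real_inner_comm] at this
  exact nonneg_of_mul_nonneg_right (by linarith : 0 ≤ r * inner ℝ ξ v) hr0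

end Potential

/-! ### Descent of a convex function along a path with jumps. -/

section Dynamics

theorem measure_lt_top_of_subset_Icc {μ : Measure ℝ≥0} (hμ : ∀ T, μ (Set.Ico 0 T) < ∞)
    {S : Set ℝ≥0} {T : ℝ≥0} (hS : S ⊆ Set.Icc 0 T) : μ S < ∞ := by
  refine (measure_mono fun x hx => ?_).trans_lt (hμ (T + 1))
  exact ⟨zero_le, (hS hx).2.trans_lt (lt_add_one T)⟩

theorem measure_Ioo_ne_top {μ : Measure ℝ≥0} (hμ : ∀ T, μ (Set.Ico 0 T) < ∞) (r s : ℝ≥0) :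
    μ (Set.Ioo r s) ≠ ∞ :=
  (measure_lt_top_of_subset_Icc (S := Set.Ioo r s) hμ fun _ hx => ⟨zero_le, hx.2.le⟩).ne

/-- The open intervals shrink to the empty set, an atom at `t` being excluded. -/
theorem exists_gt_measureReal_Ioo_lt {μ : Measure ℝ≥0} (hμ : ∀ T, μ (Set.Ico 0 T) < ∞) (t : ℝ≥0)
    {η : ℝ} (hη : 0 < η) : ∃ s > t, μ.real (Set.Ioo t s) < η := by
  obtain ⟨u, hu, hut, hlim⟩ := exists_seq_strictAnti_tendsto t
  have hfin : ∀ k, μ (Set.Ioo t (u k)) ≠ ∞ := fun k => measure_Ioo_ne_top hμ t (u k)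
  have h := tendsto_measure_iInter_atTop (μ := μ) (s := fun k => Set.Ioo t (u k))
    (fun k => measurableSet_Ioo.nullMeasurableSet)
    (fun i j hij => Set.Ioo_subset_Ioo_right (hu.antitone hij)) ⟨0, hfin 0⟩
  have he : ⋂ k, Set.Ioo t (u k) = ∅ := by
    refine Set.eq_empty_of_forall_notMem fun x hx => ?_
    rw [Set.mem_iInter] at hx
    obtain ⟨k, hk⟩ := (hlim.eventually_lt_const (hx 0).1).exists
    exact (hx k).2.not_gt hk
  rw [he, measure_empty] at h
  obtain ⟨k, hk⟩ := (h.eventually_lt_const (ENNReal.ofReal_pos.2 hη)).exists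
  exact ⟨u k, hut k, (ENNReal.lt_ofReal_iff_toReal_lt (hfin k)).1 hk⟩

theorem exists_lt_measureReal_Ioo_lt {μ : Measure ℝ≥0} (hμ : ∀ T, μ (Set.Ico 0 T) < ∞) {t : ℝ≥0}
    (ht : 0 < t) {η : ℝ} (hη : 0 < η) : ∃ s < t, μ.real (Set.Ioo s t) < η := by
  obtain ⟨u, hu, hut, hlim⟩ := exists_seq_strictMono_tendsto' ht
  have hfin : ∀ k, μ (Set.Ioo (u k) t) ≠ ∞ := fun k => measure_Ioo_ne_top hμ (u k) t
  have h := tendsto_measure_iInter_atTop (μ := μ) (s := fun k => Set.Ioo (u k) t)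
    (fun k => measurableSet_Ioo.nullMeasurableSet)
    (fun i j hij => Set.Ioo_subset_Ioo_left (hu.monotone hij)) ⟨0, hfin 0⟩
  have he : ⋂ k, Set.Ioo (u k) t = ∅ := by
    refine Set.eq_empty_of_forall_notMem fun x hx => ?_
    rw [Set.mem_iInter] at hx
    obtain ⟨k, hk⟩ := (hlim.eventually_const_lt (hx 0).2).exists
    exact (hx k).1.not_gt hk
  rw [he, measure_empty] at h
  obtain ⟨k, hk⟩ := (h.eventually_lt_const (ENNReal.ofReal_pos.2 hη)).exists
  exact ⟨u k, (hut k).2, (ENNReal.lt_ofReal_iff_toReal_lt (hfin k)).1 hk⟩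

theorem integrableOn_of_norm_le_one {E : Type*} [NormedAddCommGroup E] {μ : Measure ℝ≥0}
    (hμ : ∀ T, μ (Set.Ico 0 T) < ∞)
    {v : ℝ≥0 → E} (hv : AEStronglyMeasurable v μ) (hv1 : ∀ s, ‖v s‖ ≤ 1)
    {S : Set ℝ≥0} {T : ℝ≥0} (hS : S ⊆ Set.Icc 0 T) : IntegrableOn v S μ :=
  IntegrableOn.of_bound (measure_lt_top_of_subset_Icc hμ hS) hv.restrict 1
    (Eventually.of_forall hv1)

variable {E : Type*} [NormedAddCommGroup E] [InnerProductSpace ℝ E]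

theorem setIntegral_Icc_sub_setIntegral_Icc {μ : Measure ℝ≥0} (hμ : ∀ T, μ (Set.Ico 0 T) < ∞)
    {v : ℝ≥0 → E} (hv : AEStronglyMeasurable v μ) (hv1 : ∀ s, ‖v s‖ ≤ 1) {r t : ℝ≥0}
    (hrt : r ≤ t) :
    ∫ s in Set.Icc 0 t, v s ∂μ - ∫ s in Set.Icc 0 r, v s ∂μ = ∫ s in Set.Ioc r t, v s ∂μ := by
  rw [← Set.Icc_union_Ioc_eq_Icc (zero_le : 0 ≤ r) hrt, setIntegral_union
    (Set.disjoint_left.2 fun x hx hx' => hx'.1.not_ge hx.2) measurableSet_Ioc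
    (integrableOn_of_norm_le_one hμ hv hv1 subset_rfl)
    (integrableOn_of_norm_le_one hμ hv hv1 fun x hx => ⟨zero_le, hx.2⟩), add_sub_cancel_left]

theorem norm_setIntegral_le_measureReal {μ : Measure ℝ≥0} (hμ : ∀ T, μ (Set.Ico 0 T) < ∞)
    {v : ℝ≥0 → E} (hv1 : ∀ s, ‖v s‖ ≤ 1) {S : Set ℝ≥0} {T : ℝ≥0} (hS : S ⊆ Set.Icc 0 T) :
    ‖∫ s in S, v s ∂μ‖ ≤ μ.real S :=
  (norm_setIntegral_le_of_norm_le_const (measure_lt_top_of_subset_Icc hμ hS)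
    fun s _ => hv1 s).trans_eq (one_mul _)

theorem inner_setIntegral_nonneg [CompleteSpace E] {μ : Measure ℝ≥0}
    (hμ : ∀ T, μ (Set.Ico 0 T) < ∞)
    {v : ℝ≥0 → E} (hv : AEStronglyMeasurable v μ) (hv1 : ∀ s, ‖v s‖ ≤ 1)
    {S : Set ℝ≥0} {T : ℝ≥0} (hS : S ⊆ Set.Icc 0 T) (hSm : MeasurableSet S) {ξ : E}
    (h : ∀ s ∈ S, 0 ≤ inner ℝ ξ (v s)) : 0 ≤ inner ℝ ξ (∫ s in S, v s ∂μ) := by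
  rw [← integral_inner (integrableOn_of_norm_le_one hμ hv hv1 hS)]
  exact setIntegral_nonneg hSm h

/-- Along a path whose increments at each time are descent directions for the subgradients of `g`
at all nearby points of the path, `g` does not exceed its value at `0`. -/
theorem le_of_subgradient_descent [CompleteSpace E] {g : E → ℝ} {z ξ v v' : ℝ≥0 → E}
    {μ μ' : Measure ℝ≥0}
    (hμ : ∀ T, μ (Set.Ico 0 T) < ∞) (hμ' : ∀ T, μ' (Set.Ico 0 T) < ∞)
    (hv : AEStronglyMeasurable v μ) (hv' : AEStronglyMeasurable v' μ')
    (hv1 : ∀ s, ‖v s‖ ≤ 1) (hv1' : ∀ s, ‖v' s‖ ≤ 1)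
    (hz : ∀ t, z t = ∫ s in Set.Icc 0 t, v' s ∂μ' - ∫ s in Set.Icc 0 t, v s ∂μ)
    {T : ℝ≥0} {η : ℝ} (hη : 0 < η)
    (hg : ∀ s w, g (z s) + inner ℝ (ξ s) (w - z s) ≤ g w)
    (hd : ∀ s ≤ T, ∀ u ≤ T, ‖z s - z u‖ < η → 0 ≤ inner ℝ (ξ s) (v u))
    (hd' : ∀ s ≤ T, ∀ u ≤ T, ‖z s - z u‖ < η → inner ℝ (ξ s) (v' u) ≤ 0)
    {t : ℝ≥0} (ht : t ≤ T) : g (z t) ≤ g 0 := by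
  have hinc : ∀ r s, r ≤ s →
      z s - z r = ∫ u in Set.Ioc r s, v' u ∂μ' - ∫ u in Set.Ioc r s, v u ∂μ := fun r s hrs => by
    rw [← setIntegral_Icc_sub_setIntegral_Icc hμ hv hv1 hrs,
      ← setIntegral_Icc_sub_setIntegral_Icc hμ' hv' hv1' hrs, hz, hz]
    abel
  have hdesc : ∀ (S : Set ℝ≥0) (s : ℝ≥0), s ≤ T → S ⊆ Set.Icc 0 s → MeasurableSet S →
      (∀ u ∈ S, ‖z s - z u‖ < η) →
      inner ℝ (ξ s) (∫ u in S, v' u ∂μ' - ∫ u in S, v u ∂μ) ≤ 0 := by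
    intro S s hsT hS hSm hclose
    have h1 := inner_setIntegral_nonneg hμ hv hv1 hS hSm (ξ := ξ s)
      fun u hu => hd s hsT u ((hS hu).2.trans hsT) (hclose u hu)
    have h2 := inner_setIntegral_nonneg hμ' hv' hv1' hS hSm (ξ := -ξ s)
      fun u hu => by
        have := hd' s hsT u ((hS hu).2.trans hsT) (hclose u hu)
        rw [inner_neg_left]
        linarith
    rw [inner_neg_left] at h2
    rw [inner_sub_right]
    linarith
  by_contra! hcon
  -- First-exit argument: at the infimum `τ` the bound still holds, and it persists just after `τ`.
  -- The subgradient is always taken at the later endpoint of an increment.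
  set B : Set ℝ≥0 := {s | s ≤ T ∧ g 0 < g (z s)} with hB
  have hBne : B.Nonempty := ⟨t, ht, hcon⟩
  set τ := sInf B with hτ
  have hτT : τ ≤ T := (csInf_le (OrderBot.bddBelow B) ⟨ht, hcon⟩).trans ht
  have hbefore : ∀ s < τ, g (z s) ≤ g 0 := fun s hs => by
    by_contra! h
    exact hs.not_ge (csInf_le (OrderBot.bddBelow B) ⟨hs.le.trans hτT, h⟩)
  have hjump : inner ℝ (ξ τ) (∫ u in {τ}, v' u ∂μ' - ∫ u in {τ}, v u ∂μ) ≤ 0 :=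
    hdesc {τ} τ hτT (by simp) (measurableSet_singleton τ) (by simpa using hη)
  have hτB : g (z τ) ≤ g 0 := by
    -- At time `0` the closed integral is itself a jump starting from `0`.
    rcases (zero_le : 0 ≤ τ).eq_or_lt with h0 | h0
    · have h1 := hg τ 0
      have h2 : z τ = ∫ u in {τ}, v' u ∂μ' - ∫ u in {τ}, v u ∂μ := by
        rw [hz, ← h0, Set.Icc_self]
      rw [← h2] at hjump
      rw [zero_sub, inner_neg_right] at h1
      linarith
    · refine le_of_forall_pos_le_add fun δ hδ => ?_
      -- The increment over `(r, τ)` costs at most `δ`, as both measures are small there; the jump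
      -- at `τ` is a descent step.
      have hpos : 0 < δ / (2 * (‖ξ τ‖ + 1)) := by positivity
      obtain ⟨r₁, hr₁, h₁⟩ := exists_lt_measureReal_Ioo_lt hμ h0 hpos
      obtain ⟨r₂, hr₂, h₂⟩ := exists_lt_measureReal_Ioo_lt hμ' h0 hpos
      set r := max r₁ r₂
      have hr : r < τ := max_lt hr₁ hr₂
      have hsub : Set.Ioo r τ ⊆ Set.Icc 0 τ := fun x hx => ⟨zero_le, hx.2.le⟩
      have e₁ : ‖∫ u in Set.Ioo r τ, v u ∂μ‖ ≤ δ / (2 * (‖ξ τ‖ + 1)) :=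
        (norm_setIntegral_le_measureReal hμ hv1 hsub).trans
          ((measureReal_mono (Set.Ioo_subset_Ioo_left (le_max_left _ _))
            (measure_Ioo_ne_top hμ _ _)).trans h₁.le)
      have e₂ : ‖∫ u in Set.Ioo r τ, v' u ∂μ'‖ ≤ δ / (2 * (‖ξ τ‖ + 1)) :=
        (norm_setIntegral_le_measureReal hμ' hv1' hsub).trans
          ((measureReal_mono (Set.Ioo_subset_Ioo_left (le_max_right _ _))
            (measure_Ioo_ne_top hμ' _ _)).trans h₂.le)
      have hsplit : z τ - z r = (∫ u in Set.Ioo r τ, v' u ∂μ' - ∫ u in Set.Ioo r τ, v u ∂μ) +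
          (∫ u in {τ}, v' u ∂μ' - ∫ u in {τ}, v u ∂μ) := by
        rw [hinc r τ hr.le, ← Set.Ioo_union_right hr, setIntegral_union (by simp)
          (measurableSet_singleton τ) (integrableOn_of_norm_le_one hμ hv hv1 hsub)
          (integrableOn_of_norm_le_one (T := τ) hμ hv hv1 (by simp)), setIntegral_union (by simp)
          (measurableSet_singleton τ) (integrableOn_of_norm_le_one hμ' hv' hv1' hsub)
          (integrableOn_of_norm_le_one (T := τ) hμ' hv' hv1' (by simp))]
        abel
      have h1 := hg τ (z r)
      rw [← neg_sub (z τ), inner_neg_right, hsplit, inner_add_right] at h1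
      have h2 := real_inner_le_norm (ξ τ)
        (∫ u in Set.Ioo r τ, v' u ∂μ' - ∫ u in Set.Ioo r τ, v u ∂μ)
      have h3 : ‖ξ τ‖ * ‖∫ u in Set.Ioo r τ, v' u ∂μ' - ∫ u in Set.Ioo r τ, v u ∂μ‖ ≤
          (‖ξ τ‖ + 1) * (δ / (2 * (‖ξ τ‖ + 1)) + δ / (2 * (‖ξ τ‖ + 1))) := by
        refine mul_le_mul (by linarith) ((norm_sub_le _ _).trans (by linarith)) (norm_nonneg _)
          (by positivity)
      have h4 : (‖ξ τ‖ + 1) * (δ / (2 * (‖ξ τ‖ + 1)) + δ / (2 * (‖ξ τ‖ + 1))) = δ := by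
        field_simp
        ring
      have := hbefore r hr
      linarith
  obtain ⟨r₁, hr₁, h₁⟩ := exists_gt_measureReal_Ioo_lt hμ τ (half_pos hη)
  obtain ⟨r₂, hr₂, h₂⟩ := exists_gt_measureReal_Ioo_lt hμ' τ (half_pos hη)
  -- On `(τ, s]` the path stays within `η` of `z s`, so the whole increment from `τ` to `s` is a
  -- descent step.
  obtain ⟨s, ⟨hsT, hs⟩, hsr⟩ := exists_lt_of_csInf_lt hBne (lt_min hr₁ hr₂)
  have hτs : τ ≤ s := csInf_le (OrderBot.bddBelow B) ⟨hsT, hs⟩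
  have h1 := hdesc (Set.Ioc τ s) s hsT (fun x hx => ⟨zero_le, hx.2⟩) measurableSet_Ioc
    fun u hu => by
      rw [hinc u s hu.2]
      have hsub : Set.Ioc u s ⊆ Set.Icc 0 s := fun x hx => ⟨zero_le, hx.2⟩
      have hsub' : ∀ r, min r₁ r₂ ≤ r → Set.Ioc u s ⊆ Set.Ioo τ r := fun r hr x hx =>
        ⟨hu.1.trans hx.1, hx.2.trans_lt (hsr.trans_le hr)⟩
      have e₁ : ‖∫ x in Set.Ioc u s, v x ∂μ‖ < η / 2 :=
        (norm_setIntegral_le_measureReal hμ hv1 hsub).trans_lt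
          ((measureReal_mono (hsub' r₁ (min_le_left _ _)) (measure_Ioo_ne_top hμ _ _)).trans_lt h₁)
      have e₂ : ‖∫ x in Set.Ioc u s, v' x ∂μ'‖ < η / 2 :=
        (norm_setIntegral_le_measureReal hμ' hv1' hsub).trans_lt
          ((measureReal_mono (hsub' r₂ (min_le_right _ _)) (measure_Ioo_ne_top hμ' _ _)).trans_lt h₂)
      exact (norm_sub_le _ _).trans_lt (by linarith)
  rw [← hinc τ s hτs] at h1
  have h2 := hg s (z τ)
  rw [← neg_sub (z s), inner_neg_right] at h2
  linarith

end Dynamics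

/-! ### The constant `α` and the Lipschitz estimate. -/

theorem exists_isLeast_projNormSqs {n m : ℕ} (a : Fin m → EuclideanSpace ℝ (Fin n))
    (ha : ∀ i, ‖a i‖ = 1) :
    ∃ α : ℝ, 0 < α ∧ α ≤ 1 / 2 ∧ (0 < m → IsLeast (projNormSqs a) (2 * α)) := by
  rcases Nat.eq_zero_or_pos m with rfl | hm
  · exact ⟨1 / 2, by norm_num, le_rfl, fun h => absurd h (lt_irrefl 0)⟩
  have hfin : (projNormSqs a).Finite := by
    refine (Set.finite_range fun p : Finset (Fin m) × Fin m =>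
      ‖(nullSpace a p.1).starProjection (a p.2)‖ ^ 2).subset ?_
    rintro r ⟨I, j, -, rfl⟩
    exact ⟨(I, j), rfl⟩
  have hone : (1 : ℝ) ∈ projNormSqs a := by
    refine ⟨∅, ⟨0, hm⟩, ?_, ?_⟩ <;> rw [starProjection_nullSpace_empty]
    · exact norm_ne_zero_iff.1 (by rw [ha]; exact one_ne_zero)
    · rw [ha, one_pow]
  obtain ⟨r, hr, hmin⟩ := Set.exists_min_image _ id hfin ⟨1, hone⟩
  have hpos : 0 < r := by
    obtain ⟨I, j, h, rfl⟩ := hr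
    exact pow_pos (norm_pos_iff.2 h) 2
  refine ⟨r / 2, by positivity, ?_, fun _ => ?_⟩
  · have : r ≤ 1 := hmin 1 hone
    linarith
  · rw [mul_div_cancel₀ r two_ne_zero]
    exact ⟨hr, fun s hs => hmin s hs⟩

/-- If the inputs differ by less than `ε` up to time `t`, then the reflection terms differ by at
most `2 * q ^ (rank / 2) * ε`. -/
theorem SolvesSkorokhod.norm_sub_sq_le {n m : ℕ} {a : Fin m → EuclideanSpace ℝ (Fin n)}
    (ha : ∀ i, ‖a i‖ = 1) {q : ℝ} (hq : 2 ≤ q)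
    (hmin : ∀ (I : Finset (Fin m)) (j : Fin m), (nullSpace a I).starProjection (a j) ≠ 0 →
      2 / q ≤ ‖(nullSpace a I).starProjection (a j)‖ ^ 2)
    {b : Fin m → ℝ} {y y' x x' φ φ' : ℝ≥0 → EuclideanSpace ℝ (Fin n)}
    (h : SolvesSkorokhod (polyhedron a b) y x φ)
    (h' : SolvesSkorokhod (polyhedron a b) y' x' φ') {t : ℝ≥0} {M ε : ℝ} (hM : 0 ≤ M)
    (hMε : M < ε) (hy : ∀ s ≤ t, ‖y s - y' s‖ ≤ M) :
    ‖φ t - φ' t‖ ^ 2 ≤ ε ^ 2 * (4 * q ^ (rowMatrix a).rank) := by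
  obtain ⟨v, μ, hv, hμ, hv1, hvN, hφ⟩ := h.reflection
  obtain ⟨v', μ', hv', hμ', hv1', hvN', hφ'⟩ := h'.reflection
  set z : ℝ≥0 → EuclideanSpace ℝ (Fin n) := fun s => φ s - φ' s with hz
  have hzx : ∀ s, z s = (x s - x' s) - (y s - y' s) := fun s => by
    rw [h.eq_add, h'.eq_add, add_sub_add_comm, add_sub_cancel_left]
  choose ξ hξ hξpos hξneg using fun s =>
    exists_potential_subgradient ha hq (hM.trans_lt hMε) hmin (z s)
  have hya : ∀ s ≤ t, ∀ i, |inner ℝ (y s - y' s) (a i)| ≤ M := fun s hs i =>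
    (abs_real_inner_le_norm _ _).trans (by rw [ha, mul_one]; exact hy s hs)
  have hzz : ∀ s u, ‖z s - z u‖ < ε - M → ∀ i, |inner ℝ (z s - z u) (a i)| < ε - M :=
    fun s u hsu i => (abs_real_inner_le_norm _ _).trans_lt (by rwa [ha, mul_one])
  have key := le_of_subgradient_descent (g := potential a q ε) (z := z) (ξ := ξ) hμ hμ' hv hv'
    (fun s => (hv1 s).elim (fun e => by rw [e]; exact zero_le_one) le_of_eq)
    (fun s => (hv1' s).elim (fun e => by rw [e]; exact zero_le_one) le_of_eq)
    (fun s => by simp only [hz, hφ, hφ', neg_sub_neg]) (T := t) (sub_pos.2 hMε) hξ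
    (fun s _ u hu hsu => inner_nonneg_of_mem_normalCone (h.mem u) (hvN u) fun i hi => by
      -- Facet `i` is active for `x u`, so `⟪z u, aᵢ⟫ ≥ -M`; moving from `z u` to `z s` uses up less
      -- than the slack `ε - M`.
      apply hξpos
      have h1 := h'.mem u i
      have h2 := abs_le.1 (hya u hu i)
      have h3 := abs_lt.1 (hzz s u hsu i)
      have h4 : inner ℝ (z u) (a i) = inner ℝ (a i) (x u) - inner ℝ (a i) (x' u) -
          inner ℝ (y u - y' u) (a i) := by
        rw [hzx, inner_sub_left, real_inner_comm (a i) (x u - x' u), inner_sub_right]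
      rw [inner_sub_left] at h3
      linarith [h3.1, h2.2])
    (fun s _ u hu hsu => by
      have := inner_nonneg_of_mem_normalCone (ξ := -ξ s) (h'.mem u) (hvN' u) fun i hi => by
        rw [inner_neg_left, neg_nonneg]
        apply hξneg
        have h1 := h.mem u i
        have h2 := abs_le.1 (hya u hu i)
        have h3 := abs_lt.1 (hzz s u hsu i)
        have h4 : inner ℝ (z u) (a i) = inner ℝ (a i) (x u) - inner ℝ (a i) (x' u) -
            inner ℝ (y u - y' u) (a i) := by
          rw [hzx, inner_sub_left, real_inner_comm (a i) (x u - x' u), inner_sub_right]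
        rw [inner_sub_left] at h3
        linarith [h3.2, h2.1]
      rwa [inner_neg_left, neg_nonneg] at this)
    le_rfl
  exact (norm_sq_le_potential a q ε (z t)).trans
    (key.trans (potential_zero_le a (by linarith) ε))

theorem SolvesSkorokhod.norm_sub_le {n m : ℕ} {a : Fin m → EuclideanSpace ℝ (Fin n)}
    (ha : ∀ i, ‖a i‖ = 1) {q : ℝ} (hq : 2 ≤ q)
    (hmin : ∀ (I : Finset (Fin m)) (j : Fin m), (nullSpace a I).starProjection (a j) ≠ 0 →
      2 / q ≤ ‖(nullSpace a I).starProjection (a j)‖ ^ 2)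
    {b : Fin m → ℝ} {y y' x x' φ φ' : ℝ≥0 → EuclideanSpace ℝ (Fin n)}
    (h : SolvesSkorokhod (polyhedron a b) y x φ)
    (h' : SolvesSkorokhod (polyhedron a b) y' x' φ') {t : ℝ≥0} {M : ℝ}
    (hy : ∀ s ≤ t, ‖y s - y' s‖ ≤ M) :
    ‖x t - x' t‖ ≤ (2 * q ^ (((rowMatrix a).rank : ℝ) / 2) + 1) * M := by
  have hM : 0 ≤ M := (norm_nonneg _).trans (hy t le_rfl)
  have hq0 : 0 ≤ q := by linarith
  have hsq : (q ^ (((rowMatrix a).rank : ℝ) / 2)) ^ 2 = q ^ (rowMatrix a).rank := by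
    rw [← Real.rpow_natCast, ← Real.rpow_mul hq0, Nat.cast_ofNat, div_mul_cancel₀ _ two_ne_zero,
      Real.rpow_natCast]
  have hφ : ‖φ t - φ' t‖ ≤ 2 * q ^ (((rowMatrix a).rank : ℝ) / 2) * M := by
    have hC : 0 < 2 * q ^ (((rowMatrix a).rank : ℝ) / 2) := by positivity
    rw [← div_le_iff₀' hC]
    -- `ε` must exceed `M` strictly to leave slack for the descent; now it tends to `M`.
    refine le_of_forall_gt_imp_ge_of_dense fun ε hε => ?_
    rw [div_le_iff₀' hC]
    refine le_of_sq_le_sq ?_ (mul_nonneg hC.le (hM.trans hε.le))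
    refine (h.norm_sub_sq_le ha hq hmin h' hM hε hy).trans_eq ?_
    rw [mul_pow, mul_pow, hsq]
    ring
  have e : x t - x' t = (φ t - φ' t) + (y t - y' t) := by
    rw [h.eq_add, h'.eq_add]
    abel
  rw [e]
  refine (norm_add_le _ _).trans ?_
  linarith [hy t le_rfl]

theorem theorem2 {n m : ℕ} (a : Fin m → EuclideanSpace ℝ (Fin n)) (ha : ∀ i, ‖a i‖ = 1) :
    ∃ α : ℝ, 0 < α ∧ α ≤ 1 / 2 ∧ (0 < m → IsLeast (projNormSqs a) (2 * α)) ∧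
      ∀ (b : Fin m → ℝ) (y y' x x' : ℝ≥0 → EuclideanSpace ℝ (Fin n)),
        IsSkorokhodSolution (polyhedron a b) y x →
        IsSkorokhodSolution (polyhedron a b) y' x' →
        ∀ t : ℝ≥0,
          ⨆ s ∈ Set.Icc 0 t, ‖x s - x' s‖ₑ ≤
            ENNReal.ofReal (6 * (1 / α) ^ (((rowMatrix a).rank : ℝ) / 2) + 1) *
              ⨆ s ∈ Set.Icc 0 t, ‖y s - y' s‖ₑ := by
  obtain ⟨α, hα0, hα, hleast⟩ := exists_isLeast_projNormSqs a ha
  refine ⟨α, hα0, hα, hleast, fun b y y' x x' ⟨φ, h⟩ ⟨φ', h'⟩ t => iSup₂_le fun s hs => ?_⟩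
  have hq : 2 ≤ 1 / α := by
    rw [le_div_iff₀ hα0]
    linarith
  have hmin : ∀ (I : Finset (Fin m)) (j : Fin m), (nullSpace a I).starProjection (a j) ≠ 0 →
      2 / (1 / α) ≤ ‖(nullSpace a I).starProjection (a j)‖ ^ 2 := fun I j hI => by
    rw [div_div_eq_mul_div, div_one]
    exact (hleast (Fin.pos j)).2 ⟨I, j, hI, rfl⟩
  have hc : 0 < (1 / α) ^ (((rowMatrix a).rank : ℝ) / 2) := by positivity
  set S := ⨆ s ∈ Set.Icc 0 t, ‖y s - y' s‖ₑ with hS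
  -- An infinite supremum makes the right side infinite, since the constant is positive.
  rcases eq_or_ne S ⊤ with htop | htop
  · rw [htop, ENNReal.mul_top (ENNReal.ofReal_pos.2 (by positivity)).ne']
    exact le_top
  have hy : ∀ u ≤ s, ‖y u - y' u‖ ≤ S.toReal := fun u hu => by
    rw [← toReal_enorm]
    exact ENNReal.toReal_mono htop
      (le_iSup₂ (f := fun s (_ : s ∈ Set.Icc 0 t) => ‖y s - y' s‖ₑ) u ⟨zero_le, hu.trans hs.2⟩)
  rw [← ofReal_norm, ← ENNReal.ofReal_toReal htop, ← ENNReal.ofReal_mul (by positivity)]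
  refine ENNReal.ofReal_le_ofReal ((h.norm_sub_le ha hq hmin h' hy).trans ?_)
  gcongr
  norm_num
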